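/- Let $(X_k)_{k\ge 1}$ be a standardized Gaussian process on a probability space $(\Omega,\mathcal F,P)$, that is, all finite-dimensional distributions of $(X_k)$ are (possibly degenerate) multivariate Gaussian and $X_k\sim\mathcal N(0,1)$ for every $k$. Let $\Phi$ be the cumulative distribution function of the standard normal law and put, for $n\ge 1$ and $t\in\mathbb R$, $$\widehat F_n(t)=\frac1n\sum_{i=1}^n \mathbf 1(\Phi(X_i)\le t),\qquad \Delta(n)=2\sum_{1\le i<j\le n}|\mathrm{Cov}(X_i,X_j)|.$$ Assume that $$\sum_{i=1}^\infty \sqrt[3]{\frac{\Delta(\lfloor\gamma^i\rfloor)}{\lfloor\gamma^i\rfloor^2}}<\infty\qquad\text{for every real }\gamma>1.$$ Then $$\sup_{t\in\mathbb R}\bigl|\widehat F_n(t)-\mathbf E\widehat F_n(t)\bigr|\longrightarrow 0\quad\text{almost surely as } n\to\infty.$$ -/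

import Mathlib

open MeasureTheory ProbabilityTheory Filter Topology

noncomputable section

namespace EmpiricalGaussian

/-- A sequence of real random variables is a standardized Gaussian process if all its
finite-dimensional distributions are (possibly degenerate) multivariate Gaussian and each variable
has the standard normal law. In this file, sequences are indexed from `0`: the variable written
`X_k` (`k ≥ 1`) on paper is `X (k - 1)`, so that `X_1, …, X_n` are the `X i` with `i < n`. -/
structure IsStandardizedGaussian {Ω : Type*} [MeasurableSpace Ω]
    (X : ℕ → Ω → ℝ) (P : Measure Ω) : Prop where
  gaussian : IsGaussianProcess X P
  standard : ∀ k, HasLaw (X k) (gaussianReal 0 1) P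

/-- The cumulative distribution function `Φ` of the standard normal law. -/
def stdNormalCDF (x : ℝ) : ℝ := cdf (gaussianReal 0 1) x

open Classical in
/-- The empirical distribution function `(1 / n) ∑_{i ≤ n} 1(Φ(X_i) ≤ t)`. -/
def empDist {Ω : Type*} (X : ℕ → Ω → ℝ) (n : ℕ) (t : ℝ) (ω : Ω) : ℝ :=
  (1 / (n : ℝ)) * ∑ i ∈ Finset.range n, if stdNormalCDF (X i ω) ≤ t then (1 : ℝ) else 0

/-- The uniform deviation `sup_t |F̂_n(t) - E F̂_n(t)|`, over all real `t`. The set of values over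
which the supremum is taken is bounded, by `1`. -/
def unifDev {Ω : Type*} [MeasurableSpace Ω] (X : ℕ → Ω → ℝ) (P : Measure Ω)
    (n : ℕ) (ω : Ω) : ℝ :=
  ⨆ t : ℝ, |empDist X n t ω - ∫ ω', empDist X n t ω' ∂P|

/-- The dependence measure `Δ(n) = 2 ∑_{i < j ≤ n} |Cov(X_i, X_j)|`. -/
def depMeasure {Ω : Type*} [MeasurableSpace Ω] (X : ℕ → Ω → ℝ) (P : Measure Ω) (n : ℕ) : ℝ :=
  2 * ∑ j ∈ Finset.range n, ∑ i ∈ Finset.range j, |covariance (X i) (X j) P|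

end EmpiricalGaussian

end

namespace EmpiricalGaussian

/-! For a standard Gaussian pair with covariance c, the residual Y - cX is independent of X.
Replacing g(Y) by g(Y - cX) therefore kills the covariance with g(X), and for K-Lipschitz g it costs
at most K|c||X|. Hence |Cov(g(X), g(Y))| ≤ 2K|c| (`abs_covariance_lipschitz_comp_le`), and sums of
g(X_i) have variance at most 2K(n + Δ(n)). Summability of Δ(n)/n² along n = ⌊γ^i⌋ then gives almost
sure convergence of the empirical means there; since g ≥ 0 the sums are monotone, which fills the
gaps (`ae_tendsto_mean`). Indicators are not Lipschitz, so they are squeezed between ramps in Φ.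
Finitely many ramps control all t up to 3/N (`abs_empDist_sub_clamp_le`), as in the
Glivenko–Cantelli theorem. -/

/-! ### Covariances of Lipschitz images of a Gaussian pair. -/

theorem integrable_of_mem_Icc {Ω : Type*} [MeasurableSpace Ω] {P : Measure Ω} [IsFiniteMeasure P]
    {U : Ω → ℝ} (hU : AEMeasurable U P) (h : ∀ ω, U ω ∈ Set.Icc (0 : ℝ) 1) : Integrable U P :=
  Integrable.of_bound hU.aestronglyMeasurable 1 (ae_of_all _ fun ω => by
    rw [Real.norm_eq_abs, abs_of_nonneg (h ω).1]; exact (h ω).2)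

theorem memLp_of_mem_Icc {Ω : Type*} [MeasurableSpace Ω] {P : Measure Ω} [IsFiniteMeasure P]
    {U : Ω → ℝ} (hU : AEMeasurable U P) (h : ∀ ω, U ω ∈ Set.Icc (0 : ℝ) 1) (p : ENNReal) :
    MemLp U p P :=
  MemLp.of_bound hU.aestronglyMeasurable 1 (ae_of_all _ fun ω => by
    rw [Real.norm_eq_abs, abs_of_nonneg (h ω).1]; exact (h ω).2)

/-- The covariance of a variable with values in `[0, 1]` with any other variable is at most twice
the first absolute moment of the latter. -/
theorem abs_covariance_le_of_mem_Icc {Ω : Type*} [MeasurableSpace Ω] {P : Measure Ω}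
    [IsProbabilityMeasure P] {U V : Ω → ℝ} (hU : AEMeasurable U P)
    (h : ∀ ω, U ω ∈ Set.Icc (0 : ℝ) 1) (hV : MemLp V 2 P) :
    |covariance U V P| ≤ 2 * ∫ ω, |V ω| ∂P := by
  have hVi : Integrable V P := hV.integrable (by norm_num)
  rw [covariance_eq_sub (memLp_of_mem_Icc hU h 2) hV]
  have h1 : |P[U * V]| ≤ ∫ ω, |V ω| ∂P := by
    refine abs_integral_le_integral_abs.trans
      (integral_mono_of_nonneg (ae_of_all _ fun ω => abs_nonneg _) hVi.abs
        (ae_of_all _ fun ω => ?_))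
    simp only [Pi.mul_apply, abs_mul]
    exact mul_le_of_le_one_left (abs_nonneg _)
      ((abs_of_nonneg (h ω).1).le.trans (h ω).2)
  have h2 : |P[V]| ≤ ∫ ω, |V ω| ∂P := abs_integral_le_integral_abs
  have h3 : |P[U]| ≤ 1 := by
    rw [abs_of_nonneg (integral_nonneg fun ω => (h ω).1)]
    calc P[U] ≤ ∫ _, (1 : ℝ) ∂P :=
          integral_mono (integrable_of_mem_Icc hU h) (integrable_const _) fun ω => (h ω).2
      _ = 1 := by simp
  calc |P[U * V] - P[U] * P[V]| ≤ |P[U * V]| + |P[U]| * |P[V]| := by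
        rw [← abs_mul]; exact abs_sub _ _
    _ ≤ (∫ ω, |V ω| ∂P) + 1 * ∫ ω, |V ω| ∂P := by gcongr
    _ = _ := by ring

theorem integral_abs_le_one_of_standard_normal {Ω : Type*} [MeasurableSpace Ω] {P : Measure Ω}
    [IsProbabilityMeasure P] {X : Ω → ℝ} (hX : HasLaw X (gaussianReal 0 1) P) :
    ∫ ω, |X ω| ∂P ≤ 1 := by
  have hm : MemLp X 2 P := HasGaussianLaw.memLp_two ⟨hX.map_eq ▸ inferInstance⟩
  have hv : variance X P = 1 := by rw [hX.variance_eq]; simp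
  have h0 : P[X] = 0 := by rw [hX.integral_eq]; simp
  rw [variance_eq_sub hm, h0] at hv
  have hi : Integrable (fun ω => X ω ^ 2) P := hm.integrable_sq
  calc ∫ ω, |X ω| ∂P ≤ ∫ ω, (1 / 2 + 1 / 2 * X ω ^ 2) ∂P := by
        refine integral_mono (hm.integrable (by norm_num)).abs
          ((integrable_const _).add (hi.const_mul _)) fun ω => ?_
        have := sq_nonneg (|X ω| - 1)
        have := sq_abs (X ω)
        simp only
        nlinarith
    _ = 1 := by
        rw [integral_add (integrable_const _) (hi.const_mul _), integral_const_mul]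
        simp at hv ⊢
        rw [hv]; norm_num

/-- For a Gaussian pair of standard normal variables, the covariance of Lipschitz images is
controlled by the covariance. -/
theorem abs_covariance_lipschitz_comp_le {Ω : Type*} [MeasurableSpace Ω] {P : Measure Ω}
    [IsProbabilityMeasure P] {X Y : Ω → ℝ} (hXY : HasGaussianLaw (fun ω => (X ω, Y ω)) P)
    (hX : HasLaw X (gaussianReal 0 1) P) {g : ℝ → ℝ} {K : NNReal} (hg : LipschitzWith K g)
    (h01 : ∀ x, g x ∈ Set.Icc (0 : ℝ) 1) :
    |covariance (fun ω => g (X ω)) (fun ω => g (Y ω)) P| ≤ 2 * K * |covariance X Y P| := by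
  set c := covariance X Y P with hc
  have hXm : MemLp X 2 P := hXY.fst.memLp_two
  have hYm : MemLp Y 2 P := hXY.snd.memLp_two
  have hXZ : HasGaussianLaw (fun ω => (X ω, Y ω - c * X ω)) P := by
    exact hXY.map_fun ((ContinuousLinearMap.fst ℝ ℝ ℝ).prod
      (ContinuousLinearMap.snd ℝ ℝ ℝ - c • ContinuousLinearMap.fst ℝ ℝ ℝ))
  have hZm : MemLp (fun ω => Y ω - c * X ω) 2 P := hXZ.snd.memLp_two
  -- Uncorrelated because Var X = 1; joint Gaussianity turns this into independence.
  have hcov : covariance X (fun ω => Y ω - c * X ω) P = 0 := by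
    rw [covariance_fun_sub_right hXm hYm (hXm.const_mul c), covariance_const_mul_right,
      covariance_self hX.aemeasurable, hX.variance_eq, ← hc]
    simp
  have hind := hXZ.indepFun_of_covariance_eq_zero hcov
  have hgm : Measurable g := hg.continuous.measurable
  have hgX := hgm.comp_aemeasurable hX.aemeasurable
  have hgY := hgm.comp_aemeasurable hYm.aemeasurable
  have hgZ := hgm.comp_aemeasurable hZm.aemeasurable
  have mX := memLp_of_mem_Icc hgX (fun ω => h01 _) 2
  have mY := memLp_of_mem_Icc hgY (fun ω => h01 _) 2
  have mZ := memLp_of_mem_Icc hgZ (fun ω => h01 _) 2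
  have h0 : covariance (g ∘ X) (g ∘ fun ω => Y ω - c * X ω) P = 0 :=
    (hind.comp hgm hgm).covariance_eq_zero mX mZ
  have h1 : covariance (g ∘ X) (g ∘ Y) P
      = covariance (g ∘ X) (g ∘ Y - g ∘ fun ω => Y ω - c * X ω) P := by
    rw [covariance_sub_right mX mY mZ, h0, sub_zero]
  change |covariance (g ∘ X) (g ∘ Y) P| ≤ _
  rw [h1]
  refine (abs_covariance_le_of_mem_Icc hgX (fun ω => h01 _) (mY.sub mZ)).trans ?_
  have h2 : ∫ ω, |(g ∘ Y - g ∘ fun ω => Y ω - c * X ω) ω| ∂P ≤ ∫ ω, K * |c| * |X ω| ∂P := by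
    refine integral_mono_of_nonneg (ae_of_all _ fun ω => abs_nonneg _)
      ((hXm.integrable (by norm_num)).abs.const_mul _) (ae_of_all _ fun ω => ?_)
    have := hg.dist_le_mul (Y ω) (Y ω - c * X ω)
    simpa [Real.dist_eq, abs_mul, mul_assoc] using this
  rw [integral_const_mul] at h2
  have h3 := mul_le_mul_of_nonneg_left (integral_abs_le_one_of_standard_normal hX)
    (by positivity : 0 ≤ (K : ℝ) * |c|)
  linarith

/-! ### The standard normal distribution function. -/

/-- The Gaussian density is bounded by 1, since 2π ≥ 1. -/
theorem lipschitzWith_stdNormalCDF : LipschitzWith 1 stdNormalCDF := by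
  refine LipschitzWith.of_le_add fun x y => ?_
  rcases le_total x y with h | h
  · exact (monotone_cdf _ h).trans (le_add_of_nonneg_right dist_nonneg)
  have hle : gaussianReal 0 1 (Set.Ioc y x) ≤ ENNReal.ofReal (x - y) := by
    rw [gaussianReal_apply _ (by simp)]
    calc ∫⁻ z in Set.Ioc y x, gaussianPDF 0 1 z ≤ ∫⁻ _ in Set.Ioc y x, 1 := by
          refine lintegral_mono fun z => ?_
          rw [gaussianPDF, ← ENNReal.ofReal_one]
          refine ENNReal.ofReal_le_ofReal ?_
          rw [gaussianPDFReal]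
          refine mul_le_one₀ (inv_le_one_of_one_le₀ ?_) (Real.exp_nonneg _)
            (Real.exp_le_one_iff.2 ?_)
          · rw [Real.one_le_sqrt]
            have := Real.pi_gt_three
            simp; linarith
          · simp only [NNReal.coe_one]
            have := sq_nonneg (z - 0)
            rw [div_nonpos_iff]; right; constructor <;> linarith
      _ = ENNReal.ofReal (x - y) := by simp
  have h2 : (gaussianReal 0 1).real (Set.Ioc y x) ≤ x - y :=
    ENNReal.toReal_le_of_le_ofReal (by linarith) hle
  have h3 : (gaussianReal 0 1).real (Set.Iic x)
      ≤ (gaussianReal 0 1).real (Set.Iic y) + (gaussianReal 0 1).real (Set.Ioc y x) := by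
    rw [← Set.Iic_union_Ioc_eq_Iic h]
    exact measureReal_union_le _ _
  rw [stdNormalCDF, stdNormalCDF, cdf_eq_real, cdf_eq_real, Real.dist_eq,
    abs_of_nonneg (by linarith)]
  linarith

theorem strictMono_stdNormalCDF : StrictMono stdNormalCDF := by
  intro x y h
  have hpos : 0 < (gaussianReal 0 1).real (Set.Ioc x y) := by
    rw [measureReal_def, ENNReal.toReal_pos_iff]
    refine ⟨pos_iff_ne_zero.2 fun h0 => ?_, measure_lt_top _ _⟩
    have := gaussianReal_absolutelyContinuous' 0 (v := 1) one_ne_zero h0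
    simp at this
    linarith
  rw [stdNormalCDF, stdNormalCDF, cdf_eq_real, cdf_eq_real, ← Set.Iic_union_Ioc_eq_Iic h.le,
    measureReal_union (Set.Iic_disjoint_Ioc le_rfl) measurableSet_Ioc]
  linarith

/-- The probability integral transform for the standard normal law. -/
theorem gaussianReal_stdNormalCDF_le {t : ℝ} (h0 : 0 < t) (h1 : t < 1) :
    (gaussianReal 0 1).real {x | stdNormalCDF x ≤ t} = t := by
  obtain ⟨a, ha⟩ : ∃ a, stdNormalCDF a = t := by
    have hbot := tendsto_cdf_atBot (gaussianReal 0 1)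
    have htop := tendsto_cdf_atTop (gaussianReal 0 1)
    exact mem_range_of_exists_le_of_exists_ge lipschitzWith_stdNormalCDF.continuous
      ((hbot.eventually (eventually_le_nhds h0)).exists)
      ((htop.eventually (eventually_ge_nhds h1)).exists)
  have : {x | stdNormalCDF x ≤ t} = Set.Iic a := by
    ext x
    rw [Set.mem_ofPred_eq, ← ha, strictMono_stdNormalCDF.le_iff_le, Set.mem_Iic]
  rw [this, ← ha, stdNormalCDF, cdf_eq_real]

/-! ### Double sums and summability. -/

theorem sum_range_sum_range_eq_of_symm (f : ℕ → ℕ → ℝ) (hf : ∀ i j, f i j = f j i) (n : ℕ) :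
    ∑ i ∈ Finset.range n, ∑ j ∈ Finset.range n, f i j
      = ∑ i ∈ Finset.range n, f i i
        + 2 * ∑ j ∈ Finset.range n, ∑ i ∈ Finset.range j, f i j := by
  induction n with
  | zero => simp
  | succ n ih =>
    have h1 : ∑ j ∈ Finset.range n, f n j = ∑ j ∈ Finset.range n, f j n :=
      Finset.sum_congr rfl fun j _ => hf n j
    simp only [Finset.sum_range_succ, Finset.sum_add_distrib, ih, h1]
    ring

/-- Nonnegative variables with summable expectations tend to zero almost surely. -/
theorem ae_tendsto_zero_of_summable_integral {Ω : Type*} [MeasurableSpace Ω] {P : Measure Ω}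
    {V : ℕ → Ω → ℝ} (hV : ∀ i, Integrable (V i) P) (h0 : ∀ i ω, 0 ≤ V i ω)
    (hs : Summable fun i => ∫ ω, V i ω ∂P) :
    ∀ᵐ ω ∂P, Tendsto (fun i => V i ω) atTop (𝓝 0) := by
  have hm : ∀ i, AEMeasurable (fun ω => ENNReal.ofReal (V i ω)) P :=
    fun i => (hV i).aemeasurable.ennreal_ofReal
  have hfin : ∫⁻ ω, ∑' i, ENNReal.ofReal (V i ω) ∂P ≠ ⊤ := by
    rw [lintegral_tsum hm]
    simp_rw [← fun i => ofReal_integral_eq_lintegral_ofReal (hV i) (ae_of_all _ (h0 i))]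
    exact hs.tsum_ofReal_ne_top
  filter_upwards [ae_lt_top' (AEMeasurable.tsum hm) hfin] with ω hω
  have := ENNReal.tendsto_atTop_zero_of_tsum_ne_top hω.ne
  have := (ENNReal.tendsto_toReal ENNReal.zero_ne_top).comp this
  simpa [Function.comp_def, ENNReal.toReal_ofReal, h0] using this

theorem depMeasure_nonneg {Ω : Type*} [MeasurableSpace Ω] (X : ℕ → Ω → ℝ) (P : Measure Ω)
    (n : ℕ) : 0 ≤ depMeasure X P n := by
  unfold depMeasure
  positivity

/-- Terms of a convergent series are eventually below 1, where a ≤ a ^ p. The cube root in the main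
hypothesis is used only through this weakening. -/
theorem summable_of_summable_rpow {a : ℕ → ℝ} (ha : ∀ i, 0 ≤ a i) {p : ℝ} (hp0 : 0 < p)
    (hp1 : p ≤ 1) (h : Summable fun i => a i ^ p) : Summable a := by
  refine h.of_norm_bounded_eventually_nat ?_
  filter_upwards [h.tendsto_atTop_zero.eventually (eventually_lt_nhds one_pos)] with i hi
  have h1 : a i ≤ 1 := by
    by_contra! hc
    exact absurd (Real.one_lt_rpow hc hp0) hi.not_gt
  rw [Real.norm_eq_abs, abs_of_nonneg (ha i)]
  exact Real.self_le_rpow_of_le_one (ha i) h1 hp1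

theorem summable_one_div_nat_floor_pow {γ : ℝ} (hγ : 1 < γ) :
    Summable fun i : ℕ => 1 / ((⌊γ ^ (i + 1)⌋₊ : ℕ) : ℝ) := by
  have h0 : 0 < γ := one_pos.trans hγ
  have h1 : 0 < 1 - γ⁻¹ := sub_pos.2 (inv_lt_one_of_one_lt₀ hγ)
  have hg : Summable fun i : ℕ => (1 - γ⁻¹)⁻¹ * γ⁻¹ ^ (i + 1) :=
    ((summable_nat_add_iff 1).2
      (summable_geometric_of_lt_one (by positivity) (inv_lt_one_of_one_lt₀ hγ))).mul_left _
  refine hg.of_nonneg_of_le (fun i => by positivity) fun i => ?_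
  calc 1 / ((⌊γ ^ (i + 1)⌋₊ : ℕ) : ℝ) ≤ 1 / ((1 - γ⁻¹) * γ ^ (i + 1)) :=
        one_div_le_one_div_of_le (by positivity) (mul_pow_le_nat_floor_pow hγ _)
    _ = _ := by rw [one_div, mul_inv, inv_pow]

/-! ### Strong law for bounded Lipschitz functions. -/

theorem IsStandardizedGaussian.integral_comp {Ω : Type*} [MeasurableSpace Ω] {P : Measure Ω}
    {X : ℕ → Ω → ℝ} (hX : IsStandardizedGaussian X P) {g : ℝ → ℝ} (hg : Measurable g) (i : ℕ) :
    ∫ ω, g (X i ω) ∂P = ∫ x, g x ∂gaussianReal 0 1 :=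
  (hX.standard i).integral_comp hg.aestronglyMeasurable

section

variable {Ω : Type*} [MeasurableSpace Ω] {P : Measure Ω} [IsProbabilityMeasure P]
  {X : ℕ → Ω → ℝ} {g : ℝ → ℝ} {K : NNReal}

theorem IsStandardizedGaussian.variance_sum_le (hX : IsStandardizedGaussian X P)
    (hg : LipschitzWith K g) (h01 : ∀ x, g x ∈ Set.Icc (0 : ℝ) 1) (n : ℕ) :
    variance (fun ω => ∑ i ∈ Finset.range n, g (X i ω)) P
      ≤ 2 * K * (n + depMeasure X P n) := by
  have hgX : ∀ i, AEMeasurable (fun ω => g (X i ω)) P := fun i =>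
    hg.continuous.measurable.comp_aemeasurable (hX.standard i).aemeasurable
  have hmem : ∀ i ∈ Finset.range n, MemLp (fun ω => g (X i ω)) 2 P := fun i _ =>
    memLp_of_mem_Icc (hgX i) (fun ω => h01 _) 2
  have hself : ∀ i, |covariance (X i) (X i) P| = 1 := fun i => by
    rw [covariance_self (hX.standard i).aemeasurable, (hX.standard i).variance_eq]
    simp
  have hsum := sum_range_sum_range_eq_of_symm (fun i j => |covariance (X i) (X j) P|)
    (fun i j => by rw [covariance_comm]) n
  simp only [hself, Finset.sum_const, Finset.card_range, nsmul_eq_mul, mul_one] at hsum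
  rw [depMeasure, ← hsum, ← covariance_self (Finset.aemeasurable_fun_sum _ fun i _ => hgX i),
    covariance_fun_sum_fun_sum' hmem hmem, Finset.mul_sum]
  refine Finset.sum_le_sum fun i _ => ?_
  rw [Finset.mul_sum]
  -- The case i = j is included: the degenerate pair (X_i, X_i) is Gaussian too, and yields the term
  -- n of the bound.
  exact Finset.sum_le_sum fun j _ => (le_abs_self _).trans
    (abs_covariance_lipschitz_comp_le hX.gaussian.hasGaussianLaw_prodMk (hX.standard i) hg h01)

/-- The mean square deviation of the empirical mean of a Lipschitz function. -/
theorem IsStandardizedGaussian.integral_sq_mean_sub_le (hX : IsStandardizedGaussian X P)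
    (hg : LipschitzWith K g) (h01 : ∀ x, g x ∈ Set.Icc (0 : ℝ) 1) {n : ℕ} (hn : n ≠ 0) :
    ∫ ω, ((∑ i ∈ Finset.range n, g (X i ω)) / n - ∫ x, g x ∂gaussianReal 0 1) ^ 2 ∂P
      ≤ 2 * K * (1 / n + depMeasure X P n / (n : ℝ) ^ 2) := by
  have hn' : (n : ℝ) ≠ 0 := Nat.cast_ne_zero.2 hn
  have hgX : ∀ i, AEMeasurable (fun ω => g (X i ω)) P := fun i =>
    hg.continuous.measurable.comp_aemeasurable (hX.standard i).aemeasurable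
  have hE : ∫ ω, ∑ i ∈ Finset.range n, g (X i ω) ∂P = n * ∫ x, g x ∂gaussianReal 0 1 := by
    rw [integral_finsetSum _ fun i _ => integrable_of_mem_Icc (hgX i) fun ω => h01 _]
    simp [hX.integral_comp hg.continuous.measurable]
  have hv := hX.variance_sum_le hg h01 n
  rw [variance_eq_integral (Finset.aemeasurable_fun_sum _ fun i _ => hgX i), hE] at hv
  calc _ = (∫ ω, ((∑ i ∈ Finset.range n, g (X i ω))
          - n * ∫ x, g x ∂gaussianReal 0 1) ^ 2 ∂P) / (n : ℝ) ^ 2 := by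
        rw [← integral_div]
        refine integral_congr_ae (ae_of_all _ fun ω => ?_)
        simp only
        field_simp
    _ ≤ 2 * K * (n + depMeasure X P n) / (n : ℝ) ^ 2 := by gcongr
    _ = _ := by field_simp

/-- The strong law of large numbers for Lipschitz functions with values in `[0, 1]`. -/
theorem IsStandardizedGaussian.ae_tendsto_mean (hX : IsStandardizedGaussian X P)
    (hsum : ∀ γ : ℝ, 1 < γ → Summable fun i : ℕ =>
      depMeasure X P ⌊γ ^ (i + 1)⌋₊ / ((⌊γ ^ (i + 1)⌋₊ : ℕ) : ℝ) ^ 2)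
    (hg : LipschitzWith K g) (h01 : ∀ x, g x ∈ Set.Icc (0 : ℝ) 1) :
    ∀ᵐ ω ∂P, Tendsto (fun n : ℕ => (∑ i ∈ Finset.range n, g (X i ω)) / n) atTop
      (𝓝 (∫ x, g x ∂gaussianReal 0 1)) := by
  have hgX : ∀ i, AEMeasurable (fun ω => g (X i ω)) P := fun i =>
    hg.continuous.measurable.comp_aemeasurable (hX.standard i).aemeasurable
  have hsub : ∀ γ : ℝ, 1 < γ → ∀ᵐ ω ∂P, Tendsto (fun k : ℕ =>
      (∑ i ∈ Finset.range ⌊γ ^ k⌋₊, g (X i ω)) / (⌊γ ^ k⌋₊ : ℕ)) atTop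
      (𝓝 (∫ x, g x ∂gaussianReal 0 1)) := by
    intro γ hγ
    have hpos : ∀ k : ℕ, ⌊γ ^ (k + 1)⌋₊ ≠ 0 := fun k =>
      (Nat.floor_pos.2 (one_le_pow₀ hγ.le)).ne'
    have key := ae_tendsto_zero_of_summable_integral (P := P)
      (V := fun k ω => ((∑ i ∈ Finset.range ⌊γ ^ (k + 1)⌋₊, g (X i ω)) / (⌊γ ^ (k + 1)⌋₊ : ℕ)
        - ∫ x, g x ∂gaussianReal 0 1) ^ 2)
      (fun k => by
        refine MemLp.integrable_sq (MemLp.sub ?_ (memLp_const _))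
        simp_rw [div_eq_mul_inv]
        exact (memLp_finsetSum _ fun i _ =>
          memLp_of_mem_Icc (hgX i) (fun ω => h01 _) 2).mul_const _)
      (fun k ω => sq_nonneg _)
      (((summable_one_div_nat_floor_pow hγ).add (hsum γ hγ)).mul_left
        (2 * (K : ℝ)) |>.of_nonneg_of_le (fun k => integral_nonneg fun ω => sq_nonneg _)
        (fun k => hX.integral_sq_mean_sub_le hg h01 (hpos k)))
    filter_upwards [key] with ω hω
    rw [← tendsto_add_atTop_iff_nat 1, ← tendsto_sub_nhds_zero_iff,
      tendsto_zero_iff_abs_tendsto_zero]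
    have := (Real.continuous_sqrt.tendsto 0).comp hω
    simpa [Function.comp_def, Real.sqrt_sq_eq_abs] using this
  have hc : ∀ k : ℕ, (1 : ℝ) < 1 + 1 / ((k : ℝ) + 1) := fun k => by
    have : 0 < 1 / ((k : ℝ) + 1) := by positivity
    linarith
  filter_upwards [ae_all_iff.2 fun k : ℕ => hsub _ (hc k)] with ω hω
  -- Countably many ratios 1 + 1/(k + 1) decreasing to 1 suffice, so a single null set is discarded.
  refine tendsto_div_of_monotone_of_tendsto_div_floor_pow
    (fun n => ∑ i ∈ Finset.range n, g (X i ω)) _ (fun m n hmn => ?_) _ hc ?_ hω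
  · exact Finset.sum_le_sum_of_subset_of_nonneg (Finset.range_mono hmn)
      fun i _ _ => (h01 _).1
  · simpa using tendsto_one_div_add_atTop_nhds_zero_nat.const_add (1 : ℝ)

end

/-! ### Ramps approximating the indicators. -/

theorem stdNormalCDF_pos (x : ℝ) : 0 < stdNormalCDF x :=
  (cdf_nonneg _ (x - 1)).trans_lt (strictMono_stdNormalCDF (by linarith))

theorem stdNormalCDF_le_one (x : ℝ) : stdNormalCDF x ≤ 1 := cdf_le_one _ x

theorem measurable_stdNormalCDF : Measurable stdNormalCDF :=
  lipschitzWith_stdNormalCDF.continuous.measurable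

theorem stdNormalCDF_le_iff_le_clamp (x t : ℝ) :
    stdNormalCDF x ≤ t ↔ stdNormalCDF x ≤ max 0 (min 1 t) := by
  have h0 := stdNormalCDF_pos x
  have h1 := stdNormalCDF_le_one x
  rw [le_max_iff, le_min_iff]
  constructor
  · exact fun h => Or.inr ⟨h1, h⟩
  · rintro (h | h)
    · exact absurd h h0.not_ge
    · exact h.2

/-- The standard normal distribution function maps the standard normal law to the uniform one. -/
theorem gaussianReal_stdNormalCDF_le_eq_clamp (t : ℝ) :
    (gaussianReal 0 1).real {x | stdNormalCDF x ≤ t} = max 0 (min 1 t) := by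
  rcases le_or_gt t 0 with h | h
  · have : {x | stdNormalCDF x ≤ t} = ∅ :=
      Set.eq_empty_of_forall_notMem fun x hx => absurd (hx.trans h) (stdNormalCDF_pos x).not_ge
    rw [this, measureReal_empty, max_eq_left ((min_le_right _ _).trans h)]
  rcases le_or_gt 1 t with h' | h'
  · have : {x | stdNormalCDF x ≤ t} = Set.univ :=
      Set.eq_univ_of_forall fun x => (stdNormalCDF_le_one x).trans h'
    rw [this, probReal_univ, min_eq_left h', max_eq_right zero_le_one]
  · rw [gaussianReal_stdNormalCDF_le h h', min_eq_right h'.le, max_eq_right h.le]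

/-- A continuous approximation of the indicator of `{x | Φ(x) ≤ t}`: it equals `1` where
`N Φ(x) ≤ k`, `0` where `k + 1 ≤ N Φ(x)`, and is linear in `Φ(x)` in between. -/
noncomputable def ramp (N : ℕ) (k : ℤ) (x : ℝ) : ℝ := max 0 (min 1 (k + 1 - N * stdNormalCDF x))

theorem ramp_mem_Icc (N : ℕ) (k : ℤ) (x : ℝ) : ramp N k x ∈ Set.Icc (0 : ℝ) 1 :=
  ⟨le_max_left _ _, max_le zero_le_one (min_le_left _ _)⟩

theorem lipschitzWith_ramp (N : ℕ) (k : ℤ) : LipschitzWith N (ramp N k) := by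
  have h : LipschitzWith N fun x => (k + 1 - N * stdNormalCDF x : ℝ) := by
    refine LipschitzWith.of_dist_le_mul fun x y => ?_
    have := lipschitzWith_stdNormalCDF.dist_le_mul x y
    rw [Real.dist_eq] at this ⊢
    rw [show (k + 1 - N * stdNormalCDF x - (k + 1 - N * stdNormalCDF y) : ℝ)
      = -(N * (stdNormalCDF x - stdNormalCDF y)) by ring, abs_neg, abs_mul, Nat.abs_cast]
    simp only [NNReal.coe_one, one_mul, NNReal.coe_natCast] at this ⊢
    gcongr
  exact (h.const_min 1).const_max 0

open Classical in
theorem ite_le_ramp {N : ℕ} {k : ℤ} {t : ℝ} (h : N * t ≤ k) (x : ℝ) :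
    (if stdNormalCDF x ≤ t then (1 : ℝ) else 0) ≤ ramp N k x := by
  split_ifs with hx
  · refine le_max_of_le_right (le_min le_rfl ?_)
    have := mul_le_mul_of_nonneg_left hx (Nat.cast_nonneg (α := ℝ) N)
    linarith
  · exact (ramp_mem_Icc N k x).1

open Classical in
theorem ramp_le_ite {N : ℕ} {k : ℤ} {t : ℝ} (h : (k : ℝ) + 1 ≤ N * t) (x : ℝ) :
    ramp N k x ≤ if stdNormalCDF x ≤ t then (1 : ℝ) else 0 := by
  split_ifs with hx
  · exact (ramp_mem_Icc N k x).2
  · refine max_le le_rfl ((min_le_right _ _).trans ?_)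
    have := mul_le_mul_of_nonneg_left (not_le.1 hx).le (Nat.cast_nonneg (α := ℝ) N)
    linarith

open Classical in
theorem integral_ite_stdNormalCDF_le (t : ℝ) :
    ∫ x, (if stdNormalCDF x ≤ t then (1 : ℝ) else 0) ∂gaussianReal 0 1 = max 0 (min 1 t) := by
  rw [← gaussianReal_stdNormalCDF_le_eq_clamp]
  exact integral_indicator_one (measurable_stdNormalCDF measurableSet_Iic)

theorem measurable_ite_stdNormalCDF_le [∀ x t, Decidable (stdNormalCDF x ≤ t)] (t : ℝ) :
    Measurable fun x => if stdNormalCDF x ≤ t then (1 : ℝ) else 0 :=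
  Measurable.ite (measurable_stdNormalCDF measurableSet_Iic) measurable_const measurable_const

open Classical in
theorem integrable_ite_stdNormalCDF_le (t : ℝ) :
    Integrable (fun x => if stdNormalCDF x ≤ t then (1 : ℝ) else 0) (gaussianReal 0 1) :=
  integrable_of_mem_Icc (measurable_ite_stdNormalCDF_le t).aemeasurable fun x => by
    split_ifs <;> simp

theorem integrable_ramp (N : ℕ) (k : ℤ) : Integrable (ramp N k) (gaussianReal 0 1) :=
  integrable_of_mem_Icc (lipschitzWith_ramp N k).continuous.measurable.aemeasurable
    (ramp_mem_Icc N k)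

/-- The ramp lies below the indicator of Φ ≤ (k + 1)/N; the lower bound on k keeps this level
nonnegative, so that clamping at 0 does no harm. -/
theorem integral_ramp_le {N : ℕ} (hN : 0 < N) {k : ℤ} (hk : -1 ≤ k) :
    ∫ x, ramp N k x ∂gaussianReal 0 1 ≤ (k + 1) / N := by
  classical
  have hN' : (0 : ℝ) < N := Nat.cast_pos.2 hN
  have hk' : (0 : ℝ) ≤ k + 1 := by exact_mod_cast (by omega : 0 ≤ k + 1)
  refine (integral_mono (integrable_ramp N k)
    (integrable_ite_stdNormalCDF_le ((k + 1) / N)) (ramp_le_ite (by field_simp; rfl))).trans ?_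
  rw [integral_ite_stdNormalCDF_le]
  exact max_le (by positivity) (min_le_right _ _)

theorem le_integral_ramp {N : ℕ} (hN : 0 < N) {k : ℤ} (hk : k ≤ N) :
    k / N ≤ ∫ x, ramp N k x ∂gaussianReal 0 1 := by
  classical
  have hN' : (0 : ℝ) < N := Nat.cast_pos.2 hN
  have hk' : (k : ℝ) ≤ N := by exact_mod_cast hk
  refine le_trans ?_ (integral_mono (integrable_ite_stdNormalCDF_le (k / N))
    (integrable_ramp N k) (ite_le_ramp (by field_simp; rfl)))
  rw [integral_ite_stdNormalCDF_le]
  exact le_max_of_le_right (le_min ((div_le_one hN').2 hk') le_rfl)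

/-! ### From ramps to the uniform deviation. -/

theorem empDist_eq_empDist_clamp {Ω : Type*} (X : ℕ → Ω → ℝ) (n : ℕ) (t : ℝ) (ω : Ω) :
    empDist X n t ω = empDist X n (max 0 (min 1 t)) ω := by
  unfold empDist
  simp_rw [← stdNormalCDF_le_iff_le_clamp]

theorem empDist_le_mean_ramp {Ω : Type*} (X : ℕ → Ω → ℝ) (n : ℕ) {N : ℕ} {k : ℤ} {t : ℝ}
    (h : N * t ≤ k) (ω : Ω) :
    empDist X n t ω ≤ (∑ i ∈ Finset.range n, ramp N k (X i ω)) / n := by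
  rw [empDist, one_div_mul_eq_div]
  exact div_le_div_of_nonneg_right (Finset.sum_le_sum fun i _ => ite_le_ramp h _) n.cast_nonneg

theorem mean_ramp_le_empDist {Ω : Type*} (X : ℕ → Ω → ℝ) (n : ℕ) {N : ℕ} {k : ℤ} {t : ℝ}
    (h : (k : ℝ) + 1 ≤ N * t) (ω : Ω) :
    (∑ i ∈ Finset.range n, ramp N k (X i ω)) / n ≤ empDist X n t ω := by
  rw [empDist, one_div_mul_eq_div]
  exact div_le_div_of_nonneg_right (Finset.sum_le_sum fun i _ => ramp_le_ite h _) n.cast_nonneg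

/-- If the empirical means of the finitely many relevant ramps are close to their expectations,
then the empirical distribution function is uniformly close to the uniform one. -/
theorem abs_empDist_sub_clamp_le {Ω : Type*} {X : ℕ → Ω → ℝ} {n N : ℕ} (hN : 0 < N) {ω : Ω}
    (h : ∀ k ∈ Finset.Icc (-1 : ℤ) (N + 1), |(∑ i ∈ Finset.range n, ramp N k (X i ω)) / n
      - ∫ x, ramp N k x ∂gaussianReal 0 1| ≤ 1 / N) (t : ℝ) :
    |empDist X n t ω - max 0 (min 1 t)| ≤ 3 / N := by
  rw [empDist_eq_empDist_clamp]
  set s : ℝ := max 0 (min 1 t) with hs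
  have hs0 : 0 ≤ s := le_max_left _ _
  have hs1 : s ≤ 1 := max_le zero_le_one (min_le_left _ _)
  have hN' : (0 : ℝ) < N := Nat.cast_pos.2 hN
  set k : ℤ := ⌊(N : ℝ) * s⌋ with hk
  have hk1 : (k : ℝ) ≤ N * s := Int.floor_le _
  have hk2 : (N : ℝ) * s < k + 1 := Int.lt_floor_add_one _
  have hk0 : 0 ≤ k := Int.floor_nonneg.2 (by positivity)
  have hkN : k ≤ N := by
    have : (k : ℝ) ≤ N := hk1.trans (mul_le_of_le_one_right hN'.le hs1)
    exact_mod_cast this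
  -- With k = ⌊Ns⌋, ramp k + 1 dominates the indicator and ramp k - 1 lies below it; as 0 ≤ k ≤ N,
  -- both indices stay in [-1, N + 1]. Their means are within 2/N of s, and the empirical error adds
  -- 1/N.
  have u1 := empDist_le_mean_ramp X n (N := N) (k := k + 1) (by push_cast; exact hk2.le) ω
  have l1 := mean_ramp_le_empDist X n (N := N) (k := k - 1) (t := s) (by push_cast; linarith) ω
  have u2 := (abs_le.1 (h (k + 1) (Finset.mem_Icc.2 (by omega)))).2
  have l2 := (abs_le.1 (h (k - 1) (Finset.mem_Icc.2 (by omega)))).1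
  have u3 := integral_ramp_le hN (k := k + 1) (by omega)
  have l3 := le_integral_ramp hN (k := k - 1) (by omega)
  push_cast at u3 l3
  have u4 : ((k : ℝ) + 1 + 1) / N ≤ s + 2 / N := by
    rw [div_le_iff₀ hN', add_mul, div_mul_cancel₀ _ hN'.ne']
    linarith
  have l4 : s - 2 / N ≤ ((k : ℝ) - 1) / N := by
    rw [le_div_iff₀ hN', sub_mul, div_mul_cancel₀ _ hN'.ne']
    linarith
  have e : (3 : ℝ) / N = 2 / N + 1 / N := by ring
  rw [abs_le]
  constructor <;> linarith

theorem IsStandardizedGaussian.integral_empDist {Ω : Type*} [MeasurableSpace Ω] {P : Measure Ω}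
    [IsProbabilityMeasure P] {X : ℕ → Ω → ℝ} (hX : IsStandardizedGaussian X P) {n : ℕ}
    (hn : n ≠ 0) (t : ℝ) : ∫ ω, empDist X n t ω ∂P = max 0 (min 1 t) := by
  classical
  unfold empDist
  rw [integral_const_mul, integral_finsetSum]
  · have := fun i => hX.integral_comp (measurable_ite_stdNormalCDF_le t) i
    simp_rw [this, integral_ite_stdNormalCDF_le]
    simp [hn]
  · exact fun i _ => integrable_of_mem_Icc ((measurable_ite_stdNormalCDF_le t).comp_aemeasurable
      (hX.standard i).aemeasurable) fun ω => by
        split_ifs <;> simp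

end EmpiricalGaussian

open EmpiricalGaussian in
theorem mainTheorem6 {Ω : Type*} [MeasurableSpace Ω] (P : Measure Ω) [IsProbabilityMeasure P]
    (X : ℕ → Ω → ℝ) (hX : EmpiricalGaussian.IsStandardizedGaussian X P)
    (hsum : ∀ γ : ℝ, 1 < γ →
      Summable (fun i : ℕ =>
        (EmpiricalGaussian.depMeasure X P ⌊γ ^ (i + 1)⌋₊ /
          ((⌊γ ^ (i + 1)⌋₊ : ℕ) : ℝ) ^ 2) ^ ((1 : ℝ) / 3))) :
    ∀ᵐ ω ∂P, Tendsto (fun n : ℕ => EmpiricalGaussian.unifDev X P n ω) atTop (𝓝 0) := by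
  have hsum' : ∀ γ : ℝ, 1 < γ → Summable fun i : ℕ =>
      depMeasure X P ⌊γ ^ (i + 1)⌋₊ / ((⌊γ ^ (i + 1)⌋₊ : ℕ) : ℝ) ^ 2 := fun γ hγ =>
    summable_of_summable_rpow (fun i => div_nonneg (depMeasure_nonneg X P _) (sq_nonneg _))
      (by norm_num) (by norm_num) (hsum γ hγ)
  filter_upwards [ae_all_iff.2 fun N : ℕ => ae_all_iff.2 fun k : ℤ =>
    hX.ae_tendsto_mean hsum' (lipschitzWith_ramp N k) (ramp_mem_Icc N k)] with ω hω
  -- The strict form n > M excludes n = 0, where the empirical distribution is 0 and its mean is not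
  -- the clamp of t.
  rw [Metric.tendsto_atTop']
  intro ε hε
  obtain ⟨N, hN⟩ := exists_nat_gt (3 / ε)
  have hN' : (0 : ℝ) < N := (by positivity : 0 < 3 / ε).trans hN
  have hN3 : 3 / (N : ℝ) < ε := by
    rw [div_lt_iff₀ hε] at hN
    rw [div_lt_iff₀ hN', mul_comm]
    exact hN
  have hev : ∀ᶠ n : ℕ in atTop, ∀ k ∈ Finset.Icc (-1 : ℤ) (N + 1),
      |(∑ i ∈ Finset.range n, ramp N k (X i ω)) / n
        - ∫ x, ramp N k x ∂gaussianReal 0 1| ≤ 1 / N := by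
    rw [eventually_all_finset]
    intro k _
    filter_upwards [Metric.tendsto_nhds.1 (hω N k) (1 / N) (by positivity)] with n hn
    exact hn.le
  obtain ⟨M, hM⟩ := eventually_atTop.1 hev
  refine ⟨M, fun n hn => ?_⟩
  have hle : unifDev X P n ω ≤ 3 / N := ciSup_le fun t => by
    rw [hX.integral_empDist (by omega)]
    exact abs_empDist_sub_clamp_le (Nat.cast_pos.1 hN') (hM n hn.le) t
  have h0 : 0 ≤ unifDev X P n ω := Real.iSup_nonneg fun t => abs_nonneg _
  rw [Real.dist_eq, sub_zero, abs_of_nonneg h0]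
  exact hle.trans_lt hN3
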